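/- Let $n \ge 0$ and let $\mathbb S^n$ be the set of real skew-symmetric $n\times n$ matrices. For a real $n \times n$ matrix $M$ put $\|M\|_1=\sum_{i,j}|M_{ij}|$ and $\|M\|_\infty=\max_{i,j}|M_{ij}|$, let $\|M\|_2$ be the largest singular value and $\|M\|_*$ the sum of the singular values of $M$, and let $\operatorname{support}(M)=\{(i,j): M_{ij}\neq 0\}$. For $\tilde S,\tilde L\in\mathbb S^n$ let $$\Omega(\tilde S)=\{N\in\mathbb S^n:\ \operatorname{support}(N)\subseteq\operatorname{support}(\tilde S)\},\qquad T(\tilde L)=\{UX^T-XU^T:\ X\in\mathbb R^{n\times r}\},$$ where $r=\operatorname{rank}\tilde L$ and $\tilde L=UDV^T$ is a compact singular value decomposition ($U,V\in\mathbb R^{n\times r}$ with orthonormal columns, $D$ diagonal with positive non-increasing diagonal entries; $T(\tilde L)$ does not depend on its choice), and let $$\mu(\tilde S)=\max_{N\in\Omega(\tilde S),\ \|N\|_\infty\le 1}\|N\|_2,\qquad \xi(\tilde L)=\max_{N\in T(\tilde L),\ \|N\|_2\le 1}\|N\|_\infty .$$ Let $C=\tilde S+\tilde L$ with $\tilde S,\tilde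 L\in\mathbb S^n$, and suppose that $\mu(\tilde S)\,\xi(\tilde L)<\tfrac16$. Then for every real $$\gamma\in\left(\frac{\xi(\tilde L)}{1-4\mu(\tilde S)\xi(\tilde L)},\ \frac{1-3\mu(\tilde S)\xi(\tilde L)}{\mu(\tilde S)}\right)$$ (the right endpoint being $+\infty$ if $\mu(\tilde S)=0$, that is, if $\tilde S=0$) the pair $(\tilde S,\tilde L)$ is the unique optimum of the program $$\min_{S,L}\ \gamma\|S\|_1+\|L\|_*\quad\text{subject to}\quad S+L=C,\ \ S+S^T=0,\ \ L+L^T=0 .$$ -/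

import Mathlib

open scoped Matrix

noncomputable section

namespace SkewDecomp

/-- The `i`-th largest singular value of `M`, counted from `0`, with multiplicity
(and `0` for `i ≥ n`). -/
def sigma {n : ℕ} (M : Matrix (Fin n) (Fin n) ℝ) (i : ℕ) : ℝ :=
  (Matrix.toEuclideanLin M).singularValues i

/-- The spectral norm: the largest singular value. -/
def norm2 {n : ℕ} (M : Matrix (Fin n) (Fin n) ℝ) : ℝ :=
  sigma M 0

/-- The nuclear norm: the sum of the singular values. -/
def normNuc {n : ℕ} (M : Matrix (Fin n) (Fin n) ℝ) : ℝ :=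
  ∑ i ∈ Finset.range n, sigma M i

/-- The entrywise `ℓ₁` norm `∑ |M i j|`. -/
def norm1 {n : ℕ} (M : Matrix (Fin n) (Fin n) ℝ) : ℝ :=
  ∑ i, ∑ j, |M i j|

/-- The entrywise maximum norm `max |M i j|` (equal to `0` for the empty matrix). -/
def normMax {n : ℕ} (M : Matrix (Fin n) (Fin n) ℝ) : ℝ :=
  ⨆ p : Fin n × Fin n, |M p.1 p.2|

/-- The set of real skew-symmetric `n × n` matrices. -/
def Skew (n : ℕ) : Set (Matrix (Fin n) (Fin n) ℝ) :=
  {M | Mᵀ = -M}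

/-- The support of a matrix: the positions of its nonzero entries. -/
def support {n : ℕ} (M : Matrix (Fin n) (Fin n) ℝ) : Set (Fin n × Fin n) :=
  {p | M p.1 p.2 ≠ 0}

/-- The tangent space `Ω(M)` at `M` to the variety of skew-symmetric matrices whose support has
at most as many elements as that of `M`. -/
def Omega {n : ℕ} (M : Matrix (Fin n) (Fin n) ℝ) : Set (Matrix (Fin n) (Fin n) ℝ) :=
  {N | N ∈ Skew n ∧ support N ⊆ support M}

/-- `M = U diag(D) Vᵀ` is a compact singular value decomposition of `M`: `U` and `V` have
orthonormal columns, and the singular values `D` are positive and in descending order. -/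
structure IsCompactSVD {n r : ℕ} (M : Matrix (Fin n) (Fin n) ℝ)
    (U : Matrix (Fin n) (Fin r) ℝ) (D : Fin r → ℝ) (V : Matrix (Fin n) (Fin r) ℝ) : Prop where
  orthU : Uᵀ * U = 1
  orthV : Vᵀ * V = 1
  pos : ∀ i, 0 < D i
  anti : Antitone D
  eq : M = U * Matrix.diagonal D * Vᵀ

/-- The tangent space `T(M)` at `M` to the manifold of skew-symmetric matrices of the same rank
`r` as `M`: all `U Xᵀ - X Uᵀ` with `X` an `n × r` matrix, where `M = U D Vᵀ` is a compact singular
value decomposition. (Any two choices of `U` differ by an orthogonal `r × r` factor on the right,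
so all of them give the same set.) -/
def T {n : ℕ} (M : Matrix (Fin n) (Fin n) ℝ) : Set (Matrix (Fin n) (Fin n) ℝ) :=
  {N | ∃ (U : Matrix (Fin n) (Fin M.rank) ℝ) (D : Fin M.rank → ℝ)
      (V : Matrix (Fin n) (Fin M.rank) ℝ), IsCompactSVD M U D V ∧
      ∃ X : Matrix (Fin n) (Fin M.rank) ℝ, N = U * Xᵀ - X * Uᵀ}

/-- `μ(S)`: the maximum of the spectral norm over the unit ball of the maximum norm in `Ω(S)`. -/
def mu {n : ℕ} (S : Matrix (Fin n) (Fin n) ℝ) : ℝ :=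
  sSup (norm2 '' {N | N ∈ Omega S ∧ normMax N ≤ 1})

/-- `ξ(L)`: the maximum of the maximum norm over the unit ball of the spectral norm in `T(L)`. -/
def xi {n : ℕ} (L : Matrix (Fin n) (Fin n) ℝ) : ℝ :=
  sSup (normMax '' {N | N ∈ T L ∧ norm2 N ≤ 1})

/-- The feasible pairs `(S, L)` of the program: `S + L = C`, `S + Sᵀ = 0`, `L + Lᵀ = 0`. -/
def feasible {n : ℕ} (C : Matrix (Fin n) (Fin n) ℝ) :
    Set (Matrix (Fin n) (Fin n) ℝ × Matrix (Fin n) (Fin n) ℝ) :=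
  {p | p.1 + p.2 = C ∧ p.1 + p.1ᵀ = 0 ∧ p.2 + p.2ᵀ = 0}

/-- The objective `γ ‖S‖₁ + ‖L‖_*`. -/
def objective {n : ℕ} (γ : ℝ) (p : Matrix (Fin n) (Fin n) ℝ × Matrix (Fin n) (Fin n) ℝ) : ℝ :=
  γ * norm1 p.1 + normNuc p.2

/-- The set of all optima of the program: the feasible pairs that minimize the objective. -/
def optima {n : ℕ} (γ : ℝ) (C : Matrix (Fin n) (Fin n) ℝ) :
    Set (Matrix (Fin n) (Fin n) ℝ × Matrix (Fin n) (Fin n) ℝ) :=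
  {p | p ∈ feasible C ∧ ∀ q ∈ feasible C, objective γ p ≤ objective γ q}

end SkewDecomp

end

/-! Optimality is certified by one matrix `Q` that is a subgradient of `γ‖·‖₁` at `S` and of the
nuclear norm at `L`. Let `P` project onto the column space of `L` and let `W = UVᵀ` be its polar
factor. `Q` must equal `γ sign S` on the support of `S`, be smaller than `γ` in absolute value off
it, have tangential part `Q - (1-P)Q(1-P) = W`, and have normal part of norm below 1.

Such a `Q` is sought as `M + R` with `M ∈ Ω(S)` and `R ∈ T(L)`. The two equality conditions become a
linear equation for `M` whose operator is the identity minus a map that shrinks elements of `Ω(S)`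
by `2μξ < 1/3` in the maximum norm, so it is solvable in finite dimension. The same estimates bound
`R` and `M`, and the two ends of the interval for `γ` are exactly what the two strict inequalities
on `Q` require.

Uniqueness uses this strictness. A perturbation `N ≠ 0` either leaves the support of `S`, which
makes the `ℓ₁` inequality strict, or lies in `Ω(S)`. Then it has a nonzero normal part, since `μξ <
1` forces `Ω(S) ∩ T(L) = 0`, and the nuclear norm inequality is strict. -/

open scoped Matrix

namespace SkewDecomp

open scoped Matrix.Norms.L2Operator

variable {n : ℕ}

/-! ### Singular values, the operator norm and the compact SVD. -/

/-- A real matrix `MᵀM` is orthogonally diagonalizable with eigenvalues the squared singular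
values of `M`. -/
theorem exists_orthogonal_diagonalization (M : Matrix (Fin n) (Fin n) ℝ) :
    ∃ V : Matrix (Fin n) (Fin n) ℝ, Vᵀ * V = 1 ∧ V * Vᵀ = 1 ∧
      Vᵀ * (Mᵀ * M) * V = Matrix.diagonal (fun i : Fin n => sigma M i ^ 2) := by
  have hn : Module.finrank ℝ (EuclideanSpace ℝ (Fin n)) = n := finrank_euclideanSpace_fin
  set A := Matrix.toEuclideanLin M with hA
  have hAA : LinearMap.adjoint A ∘ₗ A = Matrix.toEuclideanLin (Mᵀ * M) := by
    rw [hA, ← Matrix.toEuclideanLin_conjTranspose_eq_adjoint,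
      Matrix.conjTranspose_eq_transpose_of_trivial]
    ext x : 1
    simp [Matrix.toLpLin_apply, Matrix.mulVec_mulVec]
  set b := A.isSymmetric_adjoint_comp_self.eigenvectorBasis hn with hb
  have heig : ∀ j, (Mᵀ * M) *ᵥ (b j).ofLp = (sigma M j ^ 2) • (b j).ofLp := by
    intro j
    have h := A.isSymmetric_adjoint_comp_self.apply_eigenvectorBasis hn j
    rw [← A.sq_singularValues_fin hn j, ← hb] at h
    have := congrArg WithLp.ofLp ((LinearMap.congr_fun hAA (b j)).symm.trans h)
    simpa [sigma, Matrix.toLpLin_apply] using this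
  let V : Matrix (Fin n) (Fin n) ℝ := Matrix.of fun i j => b j i
  have hV : Vᵀ * V = 1 := by
    ext i j
    have h := orthonormal_iff_ite.mp b.orthonormal i j
    rw [Matrix.mul_apply, Matrix.one_apply, ← h, PiLp.inner_apply]
    simp [V, mul_comm]
  refine ⟨V, hV, mul_eq_one_comm.mp hV, ?_⟩
  have h2 : (Mᵀ * M) * V = V * Matrix.diagonal (fun i : Fin n => sigma M i ^ 2) := by
    ext i j
    rw [Matrix.mul_diagonal]
    have := congrFun (heig j) i
    simpa [V, Matrix.mulVec, dotProduct, Matrix.mul_apply, mul_comm] using this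
  rw [Matrix.mul_assoc, h2, ← Matrix.mul_assoc, hV, Matrix.one_mul]

theorem sigma_nonneg (M : Matrix (Fin n) (Fin n) ℝ) (i : ℕ) : 0 ≤ sigma M i :=
  LinearMap.singularValues_nonneg _ _

theorem sigma_antitone (M : Matrix (Fin n) (Fin n) ℝ) : Antitone (sigma M) :=
  LinearMap.singularValues_antitone _

theorem norm_transpose_mul_self {m k : ℕ} (A : Matrix (Fin m) (Fin k) ℝ) :
    ‖Aᵀ * A‖ = ‖A‖ * ‖A‖ := by
  rw [← Matrix.conjTranspose_eq_transpose_of_trivial]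
  exact Matrix.l2_opNorm_conjTranspose_mul_self A

theorem norm_transpose {m k : ℕ} (A : Matrix (Fin m) (Fin k) ℝ) : ‖Aᵀ‖ = ‖A‖ := by
  rw [← Matrix.conjTranspose_eq_transpose_of_trivial]
  exact Matrix.l2_opNorm_conjTranspose A

theorem norm_one_le (k : ℕ) : ‖(1 : Matrix (Fin k) (Fin k) ℝ)‖ ≤ 1 := by
  rw [← Matrix.diagonal_one, Matrix.l2_opNorm_diagonal]
  exact (pi_norm_le_iff_of_nonneg zero_le_one).mpr fun i => by simp

theorem norm_le_one_of_transpose_mul_self {m k : ℕ} {A : Matrix (Fin m) (Fin k) ℝ}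
    (h : Aᵀ * A = 1) : ‖A‖ ≤ 1 := by
  have h1 := norm_transpose_mul_self A
  have h2 := norm_one_le k
  rw [h] at h1
  nlinarith [norm_nonneg A]

theorem norm_le_one_of_isProj {P : Matrix (Fin n) (Fin n) ℝ} (hT : Pᵀ = P) (h : P * P = P) :
    ‖P‖ ≤ 1 := by
  have h1 := norm_transpose_mul_self P
  rw [hT, h] at h1
  nlinarith [norm_nonneg P]

/-- Orthogonal conjugation preserves the norm, so `‖M‖² = ‖MᵀM‖` is the largest squared singular
value. From here on the spectral norm is handled as the operator norm. -/
theorem norm2_eq_norm (M : Matrix (Fin n) (Fin n) ℝ) : norm2 M = ‖M‖ := by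
  obtain ⟨V, hV, hV', hd⟩ := exists_orthogonal_diagonalization M
  have hn1 : ‖V‖ ≤ 1 := norm_le_one_of_transpose_mul_self hV
  have hn2 : ‖Vᵀ‖ ≤ 1 := (norm_transpose V).trans_le hn1
  have hM : Mᵀ * M = V * Matrix.diagonal (fun i : Fin n => sigma M i ^ 2) * Vᵀ := by
    rw [← hd]
    calc Mᵀ * M = (V * Vᵀ) * (Mᵀ * M) * (V * Vᵀ) := by rw [hV']; simp
      _ = _ := by simp only [Matrix.mul_assoc]
  have hD : ‖Mᵀ * M‖ = ‖Matrix.diagonal (fun i : Fin n => sigma M i ^ 2)‖ := by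
    apply le_antisymm
    · rw [hM]
      refine (norm_mul_le _ _).trans ((mul_le_of_le_one_right (norm_nonneg _) hn2).trans ?_)
      exact (norm_mul_le _ _).trans (mul_le_of_le_one_left (norm_nonneg _) hn1)
    · rw [← hd]
      refine (norm_mul_le _ _).trans ((mul_le_of_le_one_right (norm_nonneg _) hn1).trans ?_)
      exact (norm_mul_le _ _).trans (mul_le_of_le_one_left (norm_nonneg _) hn2)
  have hD2 : ‖Matrix.diagonal (fun i : Fin n => sigma M i ^ 2)‖ = sigma M 0 ^ 2 := by
    rw [Matrix.l2_opNorm_diagonal]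
    apply le_antisymm
    · refine (pi_norm_le_iff_of_nonneg (sq_nonneg _)).mpr fun i => ?_
      rw [Real.norm_of_nonneg (sq_nonneg _)]
      exact pow_le_pow_left₀ (sigma_nonneg _ _) (sigma_antitone M (Nat.zero_le _)) 2
    · rcases Nat.eq_zero_or_pos n with rfl | h
      · have : sigma M 0 = 0 :=
          LinearMap.singularValues_of_finrank_le _ (by simp)
        rw [this]; simp
      · have := norm_le_pi_norm (fun i : Fin n => sigma M i ^ 2) ⟨0, h⟩
        rwa [Real.norm_of_nonneg (sq_nonneg _)] at this
  rw [norm_transpose_mul_self, hD2] at hD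
  exact ((pow_left_inj₀ (norm_nonneg M) (sigma_nonneg M 0) two_ne_zero).mp
    (by rw [pow_two, hD])).symm

theorem finrank_range_toEuclideanLin (M : Matrix (Fin n) (Fin n) ℝ) :
    Module.finrank ℝ (LinearMap.range (Matrix.toEuclideanLin M)) = M.rank := by
  rw [Matrix.toEuclideanLin_eq_toLin_orthonormal]
  exact (Matrix.rank_eq_finrank_range_toLin M _ _).symm

/-- Keep the first `M.rank` columns `V₁` of the diagonalizing `V` and put `U = M V₁ D⁻¹`. Nothing is
lost, because `M` kills the remaining columns. -/
theorem exists_isCompactSVD (M : Matrix (Fin n) (Fin n) ℝ) :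
    ∃ (U : Matrix (Fin n) (Fin M.rank) ℝ) (D : Fin M.rank → ℝ)
      (V : Matrix (Fin n) (Fin M.rank) ℝ), IsCompactSVD M U D V ∧ ∑ i, D i = normNuc M := by
  obtain ⟨V, hV, hV', hd⟩ := exists_orthogonal_diagonalization M
  have hr : M.rank ≤ n := by simpa using M.rank_le_width
  have hpos : ∀ i : ℕ, 0 < sigma M i ↔ i < M.rank := fun i => by
    rw [← finrank_range_toEuclideanLin]
    exact LinearMap.singularValues_pos_iff_lt_finrank_range _
  have hzero : ∀ i : ℕ, M.rank ≤ i → sigma M i = 0 := fun i hi =>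
    le_antisymm (not_lt.mp fun h => absurd ((hpos i).mp h) (not_lt.mpr hi)) (sigma_nonneg M i)
  set e : Fin M.rank → Fin n := Fin.castLE hr with he
  have hei : Function.Injective e := Fin.castLE_injective hr
  set D : Fin M.rank → ℝ := fun i => sigma M i with hD
  have hDpos : ∀ i, 0 < D i := fun i => (hpos i).mpr i.2
  set V₁ : Matrix (Fin n) (Fin M.rank) ℝ := V.submatrix id e with hV₁
  have hV₁V₁ : V₁ᵀ * V₁ = 1 := by
    have : V₁ᵀ * V₁ = (Vᵀ * V).submatrix e e := by
      ext i j; simp [V₁, Matrix.mul_apply]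
    rw [this, hV, Matrix.submatrix_one _ hei]
  have hmid : V₁ᵀ * (Mᵀ * M) * V₁ = Matrix.diagonal (fun i => D i ^ 2) := by
    have : V₁ᵀ * (Mᵀ * M) * V₁ = (Vᵀ * (Mᵀ * M) * V).submatrix e e := by
      ext i j; simp [V₁, Matrix.mul_apply]
    rw [this, hd]
    ext i j
    simp [Matrix.diagonal_apply, hei.eq_iff, D, e]
  have hcol : ∀ j : Fin n, M.rank ≤ j → ∀ i, (M * V) i j = 0 := by
    intro j hj i
    have h1 : ((M * V)ᵀ * (M * V)) j j = 0 := by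
      rw [Matrix.transpose_mul, Matrix.mul_assoc, ← Matrix.mul_assoc Mᵀ, ← Matrix.mul_assoc, hd,
        Matrix.diagonal_apply_eq, hzero _ hj]
      norm_num
    rw [Matrix.mul_apply] at h1
    have h2 := (Finset.sum_eq_zero_iff_of_nonneg (fun k _ => by
      rw [Matrix.transpose_apply]; exact mul_self_nonneg _)).mp h1 i (Finset.mem_univ _)
    simpa using h2
  have hMVV : M * V₁ * V₁ᵀ = M := by
    have : M * V₁ * V₁ᵀ = M * V * Vᵀ := by
      ext i k
      rw [Matrix.mul_apply, Matrix.mul_apply]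
      have : ∀ j : Fin M.rank, (M * V₁) i j * V₁ᵀ j k = (M * V) i (e j) * Vᵀ (e j) k := fun j => by
        simp [V₁, Matrix.mul_apply]
      refine Finset.sum_of_injOn e hei.injOn (by simp) (fun j _ hj => ?_) fun j _ => this j
      rw [hcol j (not_lt.mp fun hlt => hj ⟨⟨j, hlt⟩, by simp, rfl⟩), zero_mul]
    rw [this, Matrix.mul_assoc, hV', Matrix.mul_one]
  have hinv : Matrix.diagonal (fun i => (D i)⁻¹) * Matrix.diagonal D = 1 := by
    rw [Matrix.diagonal_mul_diagonal, ← Matrix.diagonal_one]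
    congr 1; ext i; exact inv_mul_cancel₀ (hDpos i).ne'
  refine ⟨M * V₁ * Matrix.diagonal (fun i => (D i)⁻¹), D, V₁, ⟨?_, hV₁V₁, hDpos, ?_, ?_⟩, ?_⟩
  · have : (M * V₁ * Matrix.diagonal (fun i => (D i)⁻¹))ᵀ *
        (M * V₁ * Matrix.diagonal (fun i => (D i)⁻¹)) =
        Matrix.diagonal (fun i => (D i)⁻¹) * (V₁ᵀ * (Mᵀ * M) * V₁) *
          Matrix.diagonal (fun i => (D i)⁻¹) := by
      simp only [Matrix.transpose_mul, Matrix.diagonal_transpose, Matrix.mul_assoc]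
    rw [this, hmid, Matrix.diagonal_mul_diagonal, Matrix.diagonal_mul_diagonal,
      ← Matrix.diagonal_one]
    congr 1; ext i
    have := (hDpos i).ne'
    field_simp
  · intro i j hij
    exact sigma_antitone M hij
  · rw [Matrix.mul_assoc (M * V₁), hinv, Matrix.mul_one, hMVV]
  · rw [normNuc, Fin.sum_univ_eq_sum_range (sigma M)]
    refine Finset.sum_subset (Finset.range_mono hr) fun i _ hi => hzero i ?_
    simpa using hi

theorem abs_entry_le_norm {m k : ℕ} (A : Matrix (Fin m) (Fin k) ℝ) (i : Fin m) (j : Fin k) :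
    |A i j| ≤ ‖A‖ := by
  have h := Matrix.l2_opNorm_mulVec A (EuclideanSpace.single j (1 : ℝ))
  have h2 := PiLp.norm_apply_le (WithLp.toLp 2 (A *ᵥ (EuclideanSpace.single j (1 : ℝ)).ofLp)) i
  refine le_trans ?_ (h2.trans (h.trans (by simp)))
  simp

/-- Duality of the spectral and the nuclear norm. -/
theorem trace_transpose_mul_le (G M : Matrix (Fin n) (Fin n) ℝ) (hG : ‖G‖ ≤ 1) :
    (Gᵀ * M).trace ≤ normNuc M := by
  obtain ⟨U, D, V, h, hsum⟩ := exists_isCompactSVD M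
  -- The trace is an average of diagonal entries of the contraction `VᵀGᵀU`, weighted by the
  -- singular values without normalization; each such entry is at most 1.
  have key : (Gᵀ * M).trace = ∑ i, D i * (Vᵀ * Gᵀ * U) i i := by
    conv_lhs => rw [h.eq, ← Matrix.mul_assoc, Matrix.trace_mul_comm, ← Matrix.mul_assoc,
      ← Matrix.mul_assoc, Matrix.trace]
    exact Finset.sum_congr rfl fun i _ => by rw [Matrix.diag_apply, Matrix.mul_diagonal, mul_comm]
  rw [key, ← hsum]
  refine Finset.sum_le_sum fun i _ => mul_le_of_le_one_right (h.pos i).le ?_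
  refine (le_abs_self _).trans ((abs_entry_le_norm _ i i).trans ?_)
  have hU := norm_le_one_of_transpose_mul_self h.orthU
  have hV := (norm_transpose V).trans_le (norm_le_one_of_transpose_mul_self h.orthV)
  have hG' := (norm_transpose G).trans_le hG
  refine (Matrix.l2_opNorm_mul _ _).trans (mul_le_one₀ ?_ (norm_nonneg _) hU)
  exact (Matrix.l2_opNorm_mul _ _).trans (mul_le_one₀ hV (norm_nonneg _) hG')

/-! ### Polar factors of skew-symmetric matrices. -/

/-- The orthogonal projection `P` onto the column space of a skew-symmetric matrix `L`, and its
orthogonal polar factor `W`. -/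
structure IsPolarPair (L P W : Matrix (Fin n) (Fin n) ℝ) : Prop where
  transpose_proj : Pᵀ = P
  proj_mul_proj : P * P = P
  proj_mul : P * L = L
  mul_proj : L * P = L
  proj_mul_polar : P * W = W
  polar_mul_proj : W * P = W
  transpose_polar : Wᵀ = -W
  norm_polar : ‖W‖ ≤ 1
  trace_polar : (Wᵀ * L).trace = normNuc L
  mem_T : ∀ N, Nᵀ = -N → (1 - P) * N * (1 - P) = 0 → N ∈ T L

/-- The polar factor of a skew-symmetric matrix is skew-symmetric. -/
theorem IsCompactSVD.transpose_polar {r : ℕ} {L : Matrix (Fin n) (Fin n) ℝ}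
    {U V : Matrix (Fin n) (Fin r) ℝ} {D : Fin r → ℝ} (h : IsCompactSVD L U D V)
    (hL : Lᵀ = -L) : ∃ Z : Matrix (Fin r) (Fin r) ℝ, Zᵀ = -Z ∧ V = U * Zᵀ := by
  set Δ := Matrix.diagonal D with hΔ
  have hΔT : Δᵀ = Δ := Matrix.diagonal_transpose D
  have e0 : V * Δ * Uᵀ = -(U * Δ * Vᵀ) := by
    have := h.eq ▸ hL
    simpa only [Matrix.transpose_mul, Matrix.transpose_transpose, hΔT, ← hΔ, Matrix.mul_assoc]
      using this
  set Z := Vᵀ * U with hZ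
  have hZT : Zᵀ = Uᵀ * V := by rw [hZ, Matrix.transpose_mul, Matrix.transpose_transpose]
  have e1 : V * Δ = -(U * (Δ * Z)) := by
    calc V * Δ = V * Δ * Uᵀ * U := by rw [Matrix.mul_assoc, h.orthU, Matrix.mul_one]
      _ = _ := by rw [e0, hZ]; simp only [Matrix.neg_mul, Matrix.mul_assoc]
  have e2 : Zᵀ * Δ = -(Δ * Z) := by
    rw [hZT, Matrix.mul_assoc, e1, Matrix.mul_neg, ← Matrix.mul_assoc, h.orthU, Matrix.one_mul]
  have e3 : Z * Δ = -(Δ * Zᵀ) := by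
    have : U * Δ = -(V * (Δ * Zᵀ)) := by
      calc U * Δ = U * Δ * Vᵀ * V := by rw [Matrix.mul_assoc, h.orthV, Matrix.mul_one]
        _ = -(V * Δ * Uᵀ) * V := by rw [e0, neg_neg]
        _ = _ := by rw [hZT]; simp only [Matrix.neg_mul, Matrix.mul_assoc]
    rw [hZ, Matrix.mul_assoc, this, Matrix.mul_neg, ← Matrix.mul_assoc, h.orthV, Matrix.one_mul]
  -- `e2` and `e3` together make `Z` commute with `Δ²`. Since `D i + D j > 0`, it then commutes with
  -- `Δ`, and `e2` reads `Zᵀ = -Z`.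
  have e4 : Z * (Δ * Δ) = (Δ * Δ) * Z := by
    rw [← Matrix.mul_assoc, e3, Matrix.neg_mul, Matrix.mul_assoc, e2, Matrix.mul_neg, neg_neg,
      Matrix.mul_assoc]
  have e5 : Z * Δ = Δ * Z := by
    ext i j
    have := congrFun (congrFun e4 i) j
    rw [hΔ, Matrix.diagonal_mul_diagonal, Matrix.mul_diagonal, Matrix.diagonal_mul] at this
    rw [hΔ, Matrix.mul_diagonal, Matrix.diagonal_mul]
    have h0 : (Z i j * D j - D i * Z i j) * (D i + D j) = 0 := by linarith
    have := add_pos (h.pos i) (h.pos j)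
    rcases mul_eq_zero.mp h0 with h0 | h0 <;> linarith
  have hinv : Δ * Matrix.diagonal (fun i => (D i)⁻¹) = 1 := by
    rw [hΔ, Matrix.diagonal_mul_diagonal, ← Matrix.diagonal_one]
    congr 1; ext i; exact mul_inv_cancel₀ (h.pos i).ne'
  have cancel : ∀ {m : ℕ} {A B : Matrix (Fin m) (Fin r) ℝ}, A * Δ = B * Δ → A = B := by
    intro m A B hAB
    have := congrArg (· * Matrix.diagonal (fun i => (D i)⁻¹)) hAB
    simpa only [Matrix.mul_assoc, hinv, Matrix.mul_one] using this
  have hskew : Zᵀ = -Z := cancel (by rw [e2, ← e5, Matrix.neg_mul])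
  refine ⟨Z, hskew, cancel ?_⟩
  rw [e1, ← e5, hskew, Matrix.mul_neg, Matrix.neg_mul, ← Matrix.mul_assoc]

/-- Take `P = UUᵀ` and `W = UVᵀ`. Skew-symmetry gives `V = UZᵀ`, so row and column spaces coincide
and the same `P` acts as the identity on both sides. -/
theorem exists_isPolarPair (L : Matrix (Fin n) (Fin n) ℝ) (hL : Lᵀ = -L) :
    ∃ P W, IsPolarPair L P W := by
  obtain ⟨U, D, V, h, hsum⟩ := exists_isCompactSVD L
  obtain ⟨Z, hZ, hV⟩ := h.transpose_polar hL
  have hPT : (U * Uᵀ)ᵀ = U * Uᵀ := by rw [Matrix.transpose_mul, Matrix.transpose_transpose]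
  have hPU : U * Uᵀ * U = U := by rw [Matrix.mul_assoc, h.orthU, Matrix.mul_one]
  have hVT : Vᵀ = Z * Uᵀ := by rw [hV, Matrix.transpose_mul, Matrix.transpose_transpose]
  have hVP : Vᵀ * (U * Uᵀ) = Vᵀ := by
    rw [hVT, Matrix.mul_assoc, ← Matrix.mul_assoc Uᵀ, h.orthU, Matrix.one_mul]
  have hWT : (U * Vᵀ)ᵀ = -(U * Vᵀ) := by
    rw [Matrix.transpose_mul, Matrix.transpose_transpose, hVT, hV, hZ]
    simp only [Matrix.mul_neg, Matrix.neg_mul, Matrix.mul_assoc]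
  refine ⟨U * Uᵀ, U * Vᵀ, hPT, ?_, ?_, ?_, ?_, ?_, hWT, ?_, ?_, ?_⟩
  · rw [← Matrix.mul_assoc, hPU]
  · refine (congrArg _ h.eq).trans (Eq.trans ?_ h.eq.symm)
    rw [← Matrix.mul_assoc, ← Matrix.mul_assoc, hPU]
  · refine (congrArg (· * (U * Uᵀ)) h.eq).trans (Eq.trans ?_ h.eq.symm)
    exact (Matrix.mul_assoc _ _ _).trans (congrArg _ hVP)
  · rw [← Matrix.mul_assoc, hPU]
  · rw [Matrix.mul_assoc, hVP]
  · have hU := norm_le_one_of_transpose_mul_self h.orthU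
    have hV := (norm_transpose V).trans_le (norm_le_one_of_transpose_mul_self h.orthV)
    exact (Matrix.l2_opNorm_mul _ _).trans (mul_le_one₀ hU (norm_nonneg _) hV)
  · refine (congrArg (fun M => ((U * Vᵀ)ᵀ * M).trace) h.eq).trans ?_
    rw [Matrix.transpose_mul, Matrix.transpose_transpose, Matrix.mul_assoc, ← Matrix.mul_assoc Uᵀ,
      ← Matrix.mul_assoc Uᵀ, h.orthU, Matrix.one_mul, Matrix.trace_mul_comm, Matrix.mul_assoc,
      h.orthV, Matrix.mul_one, Matrix.trace_diagonal, hsum]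
  · intro N hN hP
    -- A tangent `N` equals `PN + NP - PNP`; the factor `1/2` divides `PNP` equally between `UXᵀ`
    -- and `XUᵀ`.
    refine ⟨U, D, V, h, (1 / 2 : ℝ) • (U * Uᵀ * N * U) - N * U, ?_⟩
    simp only [Matrix.transpose_sub, Matrix.transpose_smul, Matrix.transpose_mul,
      Matrix.transpose_transpose, hN]
    have h1 : N = U * Uᵀ * N + N * (U * Uᵀ) - U * Uᵀ * N * (U * Uᵀ) := by
      have : (1 - U * Uᵀ) * N * (1 - U * Uᵀ) =
          N - (U * Uᵀ * N + N * (U * Uᵀ) - U * Uᵀ * N * (U * Uᵀ)) := by noncomm_ring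
      rw [this] at hP
      exact sub_eq_zero.mp hP
    have h2 : U * ((1 / 2 : ℝ) • (Uᵀ * (-N * (U * Uᵀ))) - Uᵀ * -N) -
        ((1 / 2 : ℝ) • (U * Uᵀ * N * U) - N * U) * Uᵀ =
        U * Uᵀ * N + N * (U * Uᵀ) - (1 / 2 + 1 / 2 : ℝ) • (U * Uᵀ * N * (U * Uᵀ)) := by
      simp only [Matrix.mul_sub, Matrix.sub_mul, Matrix.mul_neg, Matrix.neg_mul, Matrix.mul_smul,
        Matrix.smul_mul, Matrix.mul_assoc, smul_neg, add_smul]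
      abel
    rw [h2, add_halves, one_smul]
    exact h1

/-! ### The maximum norm and the inequalities given by `mu` and `xi`. -/

theorem abs_le_normMax (M : Matrix (Fin n) (Fin n) ℝ) (i j : Fin n) : |M i j| ≤ normMax M :=
  le_ciSup (f := fun p : Fin n × Fin n => |M p.1 p.2|) (Set.finite_range _).bddAbove (i, j)

theorem normMax_nonneg (M : Matrix (Fin n) (Fin n) ℝ) : 0 ≤ normMax M :=
  Real.iSup_nonneg fun _ => abs_nonneg _

theorem normMax_le {M : Matrix (Fin n) (Fin n) ℝ} {c : ℝ} (hc : 0 ≤ c)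
    (h : ∀ i j, |M i j| ≤ c) : normMax M ≤ c :=
  Real.iSup_le (fun p => h p.1 p.2) hc

theorem normMax_le_norm (M : Matrix (Fin n) (Fin n) ℝ) : normMax M ≤ ‖M‖ :=
  normMax_le (norm_nonneg _) (abs_entry_le_norm M)

theorem normMax_smul_le {a : ℝ} (ha : 0 ≤ a) (M : Matrix (Fin n) (Fin n) ℝ) :
    normMax (a • M) ≤ a * normMax M :=
  normMax_le (mul_nonneg ha (normMax_nonneg M)) fun i j => by
    rw [Matrix.smul_apply, smul_eq_mul, abs_mul, abs_of_nonneg ha]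
    exact mul_le_mul_of_nonneg_left (abs_le_normMax M i j) ha

theorem eq_zero_of_normMax_le_zero {M : Matrix (Fin n) (Fin n) ℝ} (h : normMax M ≤ 0) :
    M = 0 := by
  ext i j
  exact abs_nonpos_iff.mp ((abs_le_normMax M i j).trans h)

/-- A crude bound, needed only to see that the supremum defining `mu` is over a bounded set. -/
theorem norm_le_sum (M : Matrix (Fin n) (Fin n) ℝ) :
    ‖M‖ ≤ ∑ i, ∑ j, |M i j| * ‖Matrix.single i j (1 : ℝ)‖ := by
  conv_lhs => rw [Matrix.matrix_eq_sum_single M]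
  refine (norm_sum_le _ _).trans (Finset.sum_le_sum fun i _ => (norm_sum_le _ _).trans
    (Finset.sum_le_sum fun j _ => ?_))
  have : Matrix.single i j (M i j) = M i j • Matrix.single i j (1 : ℝ) := by
    rw [Matrix.smul_single, smul_eq_mul, mul_one]
  rw [this, norm_smul, Real.norm_eq_abs]

theorem mu_nonneg (S : Matrix (Fin n) (Fin n) ℝ) : 0 ≤ mu S :=
  Real.sSup_nonneg fun _ ⟨N, _, h⟩ => h ▸ sigma_nonneg N 0

theorem xi_nonneg (L : Matrix (Fin n) (Fin n) ℝ) : 0 ≤ xi L :=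
  Real.sSup_nonneg fun _ ⟨N, _, h⟩ => h ▸ normMax_nonneg N

/-- Rescale `N` to maximum norm 1. Boundedness has to be checked because `sSup` of an unbounded set
of reals is 0. -/
theorem norm_le_mu_mul {S N : Matrix (Fin n) (Fin n) ℝ} (hN : N ∈ Omega S) :
    ‖N‖ ≤ mu S * normMax N := by
  rcases (normMax_nonneg N).eq_or_lt with h0 | h0
  · rw [eq_zero_of_normMax_le_zero h0.ge, norm_zero]
    exact mul_nonneg (mu_nonneg S) (normMax_nonneg _)
  have hbdd : BddAbove (norm2 '' {N | N ∈ Omega S ∧ normMax N ≤ 1}) := by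
    refine ⟨∑ i, ∑ j, ‖(Matrix.single i j (1 : ℝ) : Matrix (Fin n) (Fin n) ℝ)‖, ?_⟩
    rintro _ ⟨M, hM, rfl⟩
    rw [norm2_eq_norm]
    exact (norm_le_sum M).trans (Finset.sum_le_sum fun i _ => Finset.sum_le_sum fun j _ =>
      mul_le_of_le_one_left (norm_nonneg _) ((abs_le_normMax M i j).trans hM.2))
  have hmem : (normMax N)⁻¹ • N ∈ {N | N ∈ Omega S ∧ normMax N ≤ 1} := by
    refine ⟨⟨?_, fun p hp => hN.2 fun h => hp ?_⟩, ?_⟩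
    · change ((normMax N)⁻¹ • N)ᵀ = -((normMax N)⁻¹ • N)
      rw [Matrix.transpose_smul, show Nᵀ = -N from hN.1, smul_neg]
    · rw [Matrix.smul_apply, h, smul_zero]
    · exact (normMax_smul_le (inv_nonneg.mpr h0.le) N).trans (inv_mul_cancel₀ h0.ne').le
  have := le_csSup hbdd (Set.mem_image_of_mem norm2 hmem)
  rw [norm2_eq_norm, norm_smul, Real.norm_of_nonneg (inv_nonneg.mpr h0.le)] at this
  rwa [mul_comm, ← inv_mul_le_iff₀ h0]

/-- The same rescaling for `xi`; vanishing of the normal part `(1-P)N(1-P)` supplies membership in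
`T L`. -/
theorem normMax_le_xi_mul {L P W N : Matrix (Fin n) (Fin n) ℝ} (h : IsPolarPair L P W)
    (hN : Nᵀ = -N) (hP : (1 - P) * N * (1 - P) = 0) : normMax N ≤ xi L * ‖N‖ := by
  rcases (norm_nonneg N).eq_or_lt with h0 | h0
  · rw [← h0, mul_zero]
    exact (normMax_le_norm N).trans h0.ge
  have hbdd : BddAbove (normMax '' {N | N ∈ T L ∧ norm2 N ≤ 1}) := by
    refine ⟨1, ?_⟩
    rintro _ ⟨M, hM, rfl⟩
    exact (normMax_le_norm M).trans (norm2_eq_norm M ▸ hM.2)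
  have hmem : ‖N‖⁻¹ • N ∈ {N | N ∈ T L ∧ norm2 N ≤ 1} := by
    refine ⟨h.mem_T _ ?_ ?_, ?_⟩
    · rw [Matrix.transpose_smul, hN, smul_neg]
    · rw [Matrix.mul_smul, Matrix.smul_mul, hP, smul_zero]
    · rw [norm2_eq_norm, norm_smul, norm_inv, norm_norm, inv_mul_cancel₀ h0.ne']
  have h1 := le_csSup hbdd (Set.mem_image_of_mem normMax hmem)
  have h2 := normMax_smul_le h0.le (‖N‖⁻¹ • N)
  rw [smul_smul, mul_inv_cancel₀ h0.ne', one_smul] at h2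
  rw [mul_comm]
  exact h2.trans (mul_le_mul_of_nonneg_left h1 h0.le)

/-! ### Tangential and normal parts of a matrix. -/

namespace IsPolarPair

variable {L P W : Matrix (Fin n) (Fin n) ℝ} (h : IsPolarPair L P W)
include h

theorem transpose_compl : (1 - P)ᵀ = 1 - P := by
  rw [Matrix.transpose_sub, Matrix.transpose_one, h.transpose_proj]

theorem compl_mul_compl : (1 - P) * (1 - P) = 1 - P := by
  rw [Matrix.mul_sub, Matrix.sub_mul, Matrix.sub_mul, h.proj_mul_proj]
  simp

theorem norm_compl : ‖1 - P‖ ≤ 1 := norm_le_one_of_isProj h.transpose_compl h.compl_mul_compl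

theorem norm_proj : ‖P‖ ≤ 1 := norm_le_one_of_isProj h.transpose_proj h.proj_mul_proj

theorem compl_mul_polar : (1 - P) * W = 0 := by
  rw [Matrix.sub_mul, h.proj_mul_polar, Matrix.one_mul, sub_self]

theorem compl_mul : (1 - P) * L = 0 := by
  rw [Matrix.sub_mul, h.proj_mul, Matrix.one_mul, sub_self]

theorem norm_compl_mul_mul_le (M : Matrix (Fin n) (Fin n) ℝ) :
    ‖(1 - P) * M * (1 - P)‖ ≤ ‖M‖ := by
  refine (norm_mul_le _ _).trans ((mul_le_of_le_one_right (norm_nonneg _) h.norm_compl).trans ?_)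
  exact (norm_mul_le _ _).trans (mul_le_of_le_one_left (norm_nonneg _) h.norm_compl)

/-- The tangential part is `PM + (1-P)MP`, two terms of norm at most `‖M‖`. This is the source of
the 2 in `2μξ`. -/
theorem norm_sub_compl_le (M : Matrix (Fin n) (Fin n) ℝ) :
    ‖M - (1 - P) * M * (1 - P)‖ ≤ 2 * ‖M‖ := by
  have : M - (1 - P) * M * (1 - P) = P * M + (1 - P) * M * P := by noncomm_ring
  rw [this, two_mul]
  refine (norm_add_le _ _).trans (add_le_add ?_ ?_)
  · exact (norm_mul_le _ _).trans (mul_le_of_le_one_left (norm_nonneg _) h.norm_proj)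
  · refine (norm_mul_le _ _).trans ((mul_le_of_le_one_right (norm_nonneg _) h.norm_proj).trans ?_)
    exact (norm_mul_le _ _).trans (mul_le_of_le_one_left (norm_nonneg _) h.norm_compl)

theorem compl_sub_compl (M : Matrix (Fin n) (Fin n) ℝ) :
    (1 - P) * (M - (1 - P) * M * (1 - P)) * (1 - P) = 0 := by
  have hK := h.compl_mul_compl
  generalize 1 - P = K at hK ⊢
  have : K * (M - K * M * K) * K = K * M * K - (K * K) * M * (K * K) := by noncomm_ring
  rw [this, hK, sub_self]

theorem transpose_compl_mul_mul {M : Matrix (Fin n) (Fin n) ℝ} (hM : Mᵀ = -M) :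
    ((1 - P) * M * (1 - P))ᵀ = -((1 - P) * M * (1 - P)) := by
  rw [Matrix.transpose_mul, Matrix.transpose_mul, h.transpose_compl, hM]
  simp only [Matrix.mul_neg, Matrix.neg_mul, Matrix.mul_assoc]

end IsPolarPair

/-! ### Contractions and the subdifferential of the nuclear norm. -/

theorem norm_le_one_iff (M : Matrix (Fin n) (Fin n) ℝ) :
    ‖M‖ ≤ 1 ↔ ∀ x : Fin n → ℝ, (M *ᵥ x) ⬝ᵥ (M *ᵥ x) ≤ x ⬝ᵥ x := by
  have hsq : ∀ x : Fin n → ℝ, x ⬝ᵥ x = ‖WithLp.toLp 2 x‖ ^ 2 := fun x => by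
    rw [EuclideanSpace.norm_sq_eq, dotProduct]
    exact Finset.sum_congr rfl fun i _ => by simp [pow_two]
  constructor
  · intro hM x
    rw [hsq, hsq]
    exact pow_le_pow_left₀ (norm_nonneg _) ((Matrix.l2_opNorm_mulVec M (WithLp.toLp 2 x)).trans
      (mul_le_of_le_one_left (norm_nonneg _) hM)) 2
  · intro hM
    rw [Matrix.l2_opNorm_def]
    refine ContinuousLinearMap.opNorm_le_bound _ zero_le_one fun x => ?_
    rw [one_mul]
    have := hM x.ofLp
    rw [hsq, hsq] at this
    exact le_of_sq_le_sq this (norm_nonneg _)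

/-- Adding to the polar factor a contraction acting between the orthogonal complements gives
a contraction. -/
theorem IsPolarPair.norm_polar_add_le {L P W F : Matrix (Fin n) (Fin n) ℝ}
    (h : IsPolarPair L P W) (hF : ‖F‖ ≤ 1) (hl : (1 - P) * F = F) (hr : F * (1 - P) = F) :
    ‖W + F‖ ≤ 1 := by
  rw [norm_le_one_iff]
  intro x
  have hW := (norm_le_one_iff W).mp h.norm_polar (P *ᵥ x)
  have hF := (norm_le_one_iff F).mp hF ((1 - P) *ᵥ x)
  -- Pythagoras twice: `W` and `F` have orthogonal ranges, and they see only the orthogonal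
  -- components `Px` and `(1-P)x`.
  have hcross : Wᵀ * F = 0 := by
    rw [← hl, ← Matrix.mul_assoc, ← h.transpose_compl, ← Matrix.transpose_mul,
      h.compl_mul_polar, Matrix.transpose_zero, Matrix.zero_mul]
  have hcross' : Pᵀ * (1 - P) = 0 := by
    rw [h.transpose_proj, Matrix.mul_sub, h.proj_mul_proj, Matrix.mul_one, sub_self]
  have dot_eq_zero : ∀ {A B : Matrix (Fin n) (Fin n) ℝ}, Aᵀ * B = 0 →
      (A *ᵥ x) ⬝ᵥ (B *ᵥ x) = 0 := by
    intro A B hAB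
    rw [Matrix.dotProduct_mulVec, ← Matrix.mulVec_transpose, Matrix.mulVec_mulVec,
      ← Matrix.transpose_transpose A, ← Matrix.transpose_mul, hAB, Matrix.transpose_zero,
      Matrix.zero_mulVec, zero_dotProduct]
  have c1 := dot_eq_zero hcross
  have c2 := dot_eq_zero hcross'
  rw [Matrix.mulVec_mulVec, h.polar_mul_proj] at hW
  rw [Matrix.mulVec_mulVec, hr] at hF
  have hx : x ⬝ᵥ x = (P *ᵥ x) ⬝ᵥ (P *ᵥ x) + ((1 - P) *ᵥ x) ⬝ᵥ ((1 - P) *ᵥ x) := by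
    have : x = P *ᵥ x + (1 - P) *ᵥ x := by rw [← Matrix.add_mulVec]; simp
    conv_lhs => rw [this]
    rw [add_dotProduct, dotProduct_add, dotProduct_add, dotProduct_comm ((1 - P) *ᵥ x) (P *ᵥ x),
      c2]
    ring
  rw [Matrix.add_mulVec, add_dotProduct, dotProduct_add, dotProduct_add,
    dotProduct_comm (F *ᵥ x) (W *ᵥ x), c1, hx]
  linarith

/-! ### The projections onto `Ω(S)` and `T(L)`. -/

open Classical in
/-- The skew-symmetric part of a matrix, restricted to the support of `S`. -/
noncomputable def maskSkew (S : Matrix (Fin n) (Fin n) ℝ) :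
    Matrix (Fin n) (Fin n) ℝ →ₗ[ℝ] Matrix (Fin n) (Fin n) ℝ where
  toFun N := Matrix.of fun i j => if S i j = 0 then 0 else (N i j - N j i) / 2
  map_add' M N := by
    ext i j
    simp only [Matrix.of_apply, Matrix.add_apply]
    split_ifs <;> ring
  map_smul' a N := by
    ext i j
    simp only [Matrix.of_apply, Matrix.smul_apply, smul_eq_mul, RingHom.id_apply]
    split_ifs <;> ring

/-- The map `N ↦ N - (1 - P) N (1 - P)`. -/
def tangentProj (P : Matrix (Fin n) (Fin n) ℝ) :
    Matrix (Fin n) (Fin n) ℝ →ₗ[ℝ] Matrix (Fin n) (Fin n) ℝ where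
  toFun N := N - (1 - P) * N * (1 - P)
  map_add' M N := by rw [Matrix.mul_add, Matrix.add_mul]; abel
  map_smul' a N := by
    rw [Matrix.mul_smul, Matrix.smul_mul, RingHom.id_apply, smul_sub]

theorem tangentProj_apply (P N : Matrix (Fin n) (Fin n) ℝ) :
    tangentProj P N = N - (1 - P) * N * (1 - P) := rfl

theorem maskSkew_apply_of_eq {S : Matrix (Fin n) (Fin n) ℝ} {i j : Fin n} (h : S i j = 0)
    (N : Matrix (Fin n) (Fin n) ℝ) : maskSkew S N i j = 0 := if_pos h

theorem maskSkew_apply_of_ne {S : Matrix (Fin n) (Fin n) ℝ} {i j : Fin n} (h : S i j ≠ 0)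
    (N : Matrix (Fin n) (Fin n) ℝ) : maskSkew S N i j = (N i j - N j i) / 2 := if_neg h

theorem apply_swap_of_transpose_eq_neg {M : Matrix (Fin n) (Fin n) ℝ} (h : Mᵀ = -M)
    (i j : Fin n) : M j i = -M i j := congrFun (congrFun h i) j

theorem maskSkew_apply_of_ne_of_skew {S N : Matrix (Fin n) (Fin n) ℝ} {i j : Fin n}
    (h : S i j ≠ 0) (hN : Nᵀ = -N) : maskSkew S N i j = N i j := by
  rw [maskSkew_apply_of_ne h, apply_swap_of_transpose_eq_neg hN]
  ring

theorem maskSkew_mem_Omega {S : Matrix (Fin n) (Fin n) ℝ} (hS : Sᵀ = -S)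
    (N : Matrix (Fin n) (Fin n) ℝ) : maskSkew S N ∈ Omega S := by
  refine ⟨?_, fun p hp hS0 => hp (maskSkew_apply_of_eq hS0 N)⟩
  ext i j
  have hji := apply_swap_of_transpose_eq_neg hS i j
  rw [Matrix.transpose_apply, Matrix.neg_apply]
  by_cases h : S i j = 0
  · rw [maskSkew_apply_of_eq h, maskSkew_apply_of_eq (by rw [hji, h, neg_zero]), neg_zero]
  · rw [maskSkew_apply_of_ne h, maskSkew_apply_of_ne (by rw [hji]; exact neg_ne_zero.mpr h)]
    ring

theorem normMax_maskSkew_le (S N : Matrix (Fin n) (Fin n) ℝ) :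
    normMax (maskSkew S N) ≤ normMax N :=
  normMax_le (normMax_nonneg N) fun i j => by
    by_cases h : S i j = 0
    · rw [maskSkew_apply_of_eq h, abs_zero]
      exact normMax_nonneg N
    · rw [maskSkew_apply_of_ne h]
      have h1 := abs_le.mp (abs_le_normMax N i j)
      have h2 := abs_le.mp (abs_le_normMax N j i)
      exact abs_le.mpr ⟨by linarith, by linarith⟩

theorem normMax_add_le (M N : Matrix (Fin n) (Fin n) ℝ) :
    normMax (M + N) ≤ normMax M + normMax N :=
  normMax_le (add_nonneg (normMax_nonneg M) (normMax_nonneg N)) fun i j =>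
    (abs_add_le _ _).trans (add_le_add (abs_le_normMax M i j) (abs_le_normMax N i j))

theorem normMax_neg_le (N : Matrix (Fin n) (Fin n) ℝ) : normMax (-N) ≤ normMax N :=
  normMax_le (normMax_nonneg N) fun i j => by
    rw [Matrix.neg_apply, abs_neg]
    exact abs_le_normMax N i j

/-! ### Construction of the dual certificate. -/

namespace IsPolarPair

variable {S L P W : Matrix (Fin n) (Fin n) ℝ} (h : IsPolarPair L P W)
include h

theorem tangentProj_skew {M : Matrix (Fin n) (Fin n) ℝ} (hM : Mᵀ = -M) :
    (tangentProj P M)ᵀ = -tangentProj P M := by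
  rw [tangentProj_apply, Matrix.transpose_sub, h.transpose_compl_mul_mul hM, hM]
  abel

/-- Chain three bounds: `xi` from maximum to spectral norm on the tangent space, the factor 2 of the
tangential part, and `mu` back to the maximum norm on `Ω(S)`. -/
theorem normMax_le_of_mem_Omega {M : Matrix (Fin n) (Fin n) ℝ} (hM : M ∈ Omega S) :
    normMax (tangentProj P M) ≤ 2 * (mu S * xi L) * normMax M := by
  have h1 := normMax_le_xi_mul h (h.tangentProj_skew hM.1) (h.compl_sub_compl M)
  have h2 := h.norm_sub_compl_le M
  have h3 := norm_le_mu_mul hM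
  have := mul_le_mul_of_nonneg_left (h2.trans (mul_le_mul_of_nonneg_left h3 zero_le_two))
    (xi_nonneg L)
  rw [tangentProj_apply] at h1 ⊢
  linarith

/-- A kernel element is a fixed point, hence lies in `Ω(S)`, where the composed map shrinks the
maximum norm by `2μξ < 1`. In finite dimension injectivity gives the surjectivity needed for the
certificate. -/
theorem injective_id_sub (hS : Sᵀ = -S) (hmx : mu S * xi L < 1 / 6) :
    Function.Injective ((LinearMap.id : Matrix (Fin n) (Fin n) ℝ →ₗ[ℝ] Matrix (Fin n) (Fin n) ℝ) -
      maskSkew S ∘ₗ tangentProj P) := by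
  rw [← LinearMap.ker_eq_bot, LinearMap.ker_eq_bot']
  intro M hM
  have hM' : M = maskSkew S (tangentProj P M) := sub_eq_zero.mp hM
  have hO : M ∈ Omega S := hM' ▸ maskSkew_mem_Omega hS _
  have h1 : normMax M ≤ 2 * (mu S * xi L) * normMax M := by
    conv_lhs => rw [hM']
    exact (normMax_maskSkew_le _ _).trans (h.normMax_le_of_mem_Omega hO)
  exact eq_zero_of_normMax_le_zero (by nlinarith [normMax_nonneg M])

/-- The dual certificate for the optimality of `(S, L)`. -/
theorem exists_dual_certificate (hS : Sᵀ = -S) (hmx : mu S * xi L < 1 / 6) {γ : ℝ}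
    (hlower : xi L / (1 - 4 * (mu S * xi L)) < γ)
    (hupper : mu S ≠ 0 → γ < (1 - 3 * (mu S * xi L)) / mu S) :
    ∃ Q : Matrix (Fin n) (Fin n) ℝ, (∀ i j, S i j ≠ 0 → Q i j = γ * Real.sign (S i j)) ∧
      (∀ i j, S i j = 0 → |Q i j| < γ) ∧ Q - (1 - P) * Q * (1 - P) = W ∧
      ‖(1 - P) * Q * (1 - P)‖ < 1 := by
  have hμ := mu_nonneg S
  have hξ := xi_nonneg L
  set μ := mu S with hμdef
  set ξ := xi L with hξdef
  have hμξ := mul_nonneg hμ hξ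
  have hlow : ξ < γ * (1 - 4 * (μ * ξ)) := (div_lt_iff₀ (by linarith)).mp hlower
  have hup : μ * γ < 1 - 3 * (μ * ξ) := by
    rcases hμ.eq_or_lt with h0 | h0
    · rw [← h0]; norm_num
    · rw [mul_comm]
      exact (lt_div_iff₀ h0).mp (hupper h0.ne')
  have hγ : 0 < γ := pos_of_mul_pos_left (hξ.trans_lt hlow) (by linarith)
  set G : Matrix (Fin n) (Fin n) ℝ := Matrix.of fun i j => γ * Real.sign (S i j) with hG
  have hGskew : Gᵀ = -G := by
    ext i j
    simp only [hG, Matrix.transpose_apply, Matrix.neg_apply, Matrix.of_apply,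
      apply_swap_of_transpose_eq_neg hS i j, Real.sign_neg]
    ring
  have hGmask : maskSkew S G = G := by
    ext i j
    by_cases hij : S i j = 0
    · rw [maskSkew_apply_of_eq hij, hG, Matrix.of_apply, hij, Real.sign_zero, mul_zero]
    · exact maskSkew_apply_of_ne_of_skew hij hGskew
  have hGnorm : normMax G ≤ γ := normMax_le hγ.le fun i j => by
    rw [hG, Matrix.of_apply, abs_mul, abs_of_pos hγ]
    refine mul_le_of_le_one_right hγ.le ?_
    rcases Real.sign_apply_eq (S i j) with hs | hs | hs <;> rw [hs] <;> norm_num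
  -- For `Q = M + R` the requirements are `M = G - maskSkew S R` and `R = W - tangentProj P M`;
  -- eliminating `R` leaves this equation for `M`.
  obtain ⟨M, hM⟩ := LinearMap.surjective_of_injective (h.injective_id_sub hS hmx)
    (G - maskSkew S W)
  have hM' : M = G - maskSkew S W + maskSkew S (tangentProj P M) := eq_add_of_sub_eq hM
  set R := W - tangentProj P M with hR
  have hMR : M = G + -maskSkew S R := by
    conv_lhs => rw [hM']
    rw [hR, map_sub]; abel
  have hMO : M ∈ Omega S := by
    have : M = maskSkew S (G - R) := by
      conv_lhs => rw [hMR]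
      rw [map_sub (maskSkew S) G R, hGmask, sub_eq_add_neg]
    rw [this]
    exact maskSkew_mem_Omega hS _
  have hMskew : Mᵀ = -M := hMO.1
  have hRskew : Rᵀ = -R := by
    rw [hR, Matrix.transpose_sub, h.transpose_polar, h.tangentProj_skew hMskew]
    abel
  have hRP : (1 - P) * R * (1 - P) = 0 := by
    rw [hR, Matrix.mul_sub (1 - P) W, Matrix.sub_mul ((1 - P) * W), h.compl_mul_polar, Matrix.zero_mul, zero_sub,
      tangentProj_apply, h.compl_sub_compl, neg_zero]
  have hRn : ‖R‖ ≤ 1 + 2 * (μ * normMax M) :=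
    (norm_sub_le _ _).trans (add_le_add h.norm_polar ((h.norm_sub_compl_le M).trans
      (mul_le_mul_of_nonneg_left (norm_le_mu_mul hMO) zero_le_two)))
  have hRmax : normMax R ≤ ξ * ‖R‖ := normMax_le_xi_mul h hRskew hRP
  have hMmax : normMax M ≤ γ + normMax R := by
    conv_lhs => rw [hMR]
    exact (normMax_add_le _ _).trans (add_le_add hGnorm
      ((normMax_neg_le _).trans (normMax_maskSkew_le _ _)))
  -- The bounds on `M` and `R` refer to each other; substituting one into the other and absorbing
  -- `2μξ` on the left closes the loop.
  have hRnorm : ‖R‖ * (1 - 2 * (μ * ξ)) ≤ 1 + 2 * (μ * γ) := by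
    have := mul_le_mul_of_nonneg_left (hMmax.trans (add_le_add_right hRmax γ)) hμ
    linarith
  have hMnorm : normMax M * (1 - 2 * (μ * ξ)) ≤ γ + ξ := by
    have := mul_le_mul_of_nonneg_left hRn hξ
    linarith
  have hpos : 0 < 1 - 2 * (μ * ξ) := by linarith
  have hQ : (1 - P) * (M + R) * (1 - P) = (1 - P) * M * (1 - P) := by
    rw [Matrix.mul_add, Matrix.add_mul, hRP, add_zero]
  refine ⟨M + R, fun i j hij => ?_, fun i j hij => ?_, ?_, ?_⟩
  · rw [Matrix.add_apply, hMR, Matrix.add_apply, Matrix.neg_apply,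
      maskSkew_apply_of_ne_of_skew hij hRskew, hG, Matrix.of_apply]
    ring
  · have h0 : M i j = 0 := by
      by_contra hne
      exact hMO.2 (show (i, j) ∈ support M from hne) hij
    rw [Matrix.add_apply, h0, zero_add]
    -- After multiplication by `1 - 2μξ` it suffices that `ξ(1 + 2μγ) < γ(1 - 2μξ)`, which is the
    -- lower bound on `γ`.
    refine ((abs_le_normMax R i j).trans hRmax).trans_lt ?_
    refine lt_of_mul_lt_mul_right ?_ hpos.le
    have := mul_le_mul_of_nonneg_left hRnorm hξ
    linarith
  · rw [hQ, hR, tangentProj_apply]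
    abel
  · rw [hQ]
    -- After multiplication by `1 - 2μξ` it suffices that `μ(γ + ξ) < 1 - 2μξ`, which is the upper
    -- bound on `γ`.
    refine ((h.norm_compl_mul_mul_le M).trans (norm_le_mu_mul hMO)).trans_lt ?_
    refine lt_of_mul_lt_mul_right ?_ hpos.le
    have := mul_le_mul_of_nonneg_left hMnorm hμ
    linarith

end IsPolarPair

/-! ### Subgradient inequalities and strict optimality. -/

theorem trace_transpose_mul_eq_sum (A B : Matrix (Fin n) (Fin n) ℝ) :
    (Aᵀ * B).trace = ∑ i, ∑ j, A i j * B i j := by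
  rw [Finset.sum_comm]
  simp [Matrix.trace, Matrix.mul_apply]

/-- The subgradient inequality for the `ℓ₁` norm at one entry. -/
theorem mul_abs_add_ge {γ s q : ℝ} (hγ : 0 < γ) (h1 : s ≠ 0 → q = γ * Real.sign s)
    (h0 : s = 0 → |q| < γ) (a : ℝ) :
    γ * |s| + q * a ≤ γ * |s + a| ∧ (s = 0 → a ≠ 0 → γ * |s| + q * a < γ * |s + a|) := by
  constructor
  · rcases lt_trichotomy s 0 with hs | rfl | hs
    · rw [h1 hs.ne, Real.sign_of_neg hs, abs_of_neg hs]
      nlinarith [neg_abs_le (s + a)]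
    · rw [abs_zero, mul_zero, zero_add, zero_add]
      refine (le_abs_self _).trans ?_
      rw [abs_mul]
      exact mul_le_mul_of_nonneg_right (h0 rfl).le (abs_nonneg a)
    · rw [h1 hs.ne', Real.sign_of_pos hs, abs_of_pos hs]
      nlinarith [le_abs_self (s + a)]
  · rintro rfl ha
    rw [abs_zero, mul_zero, zero_add, zero_add]
    refine (le_abs_self _).trans_lt ?_
    rw [abs_mul]
    exact mul_lt_mul_of_pos_right (h0 rfl) (abs_pos.mpr ha)

/-- The terms linear in `N`, `⟨Q, N⟩` from the `ℓ₁` norm and `-⟨Q, N⟩` from the nuclear norm,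
cancel; strictness comes from one of the two subgradient inequalities. -/
theorem IsPolarPair.objective_lt {S L P W : Matrix (Fin n) (Fin n) ℝ} (h : IsPolarPair L P W)
    (hS : Sᵀ = -S) (hmx : mu S * xi L < 1 / 6) {γ : ℝ}
    (hlower : xi L / (1 - 4 * (mu S * xi L)) < γ)
    (hupper : mu S ≠ 0 → γ < (1 - 3 * (mu S * xi L)) / mu S)
    {N : Matrix (Fin n) (Fin n) ℝ} (hN : Nᵀ = -N) (hN0 : N ≠ 0) :
    objective γ (S, L) < objective γ (S + N, L - N) := by
  have hγ : 0 < γ := (div_nonneg (xi_nonneg L) (by linarith)).trans_lt hlower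
  obtain ⟨Q, hQ1, hQ0, hQT, hQn⟩ := h.exists_dual_certificate hS hmx hlower hupper
  have hent : ∀ i j, γ * |S i j| + Q i j * N i j ≤ γ * |(S + N) i j| ∧ (S i j = 0 → N i j ≠ 0 →
      γ * |S i j| + Q i j * N i j < γ * |(S + N) i j|) := fun i j =>
    mul_abs_add_ge hγ (hQ1 i j) (hQ0 i j) (N i j)
  have hsum : γ * norm1 S + (Qᵀ * N).trace = ∑ i, ∑ j, (γ * |S i j| + Q i j * N i j) := by
    rw [trace_transpose_mul_eq_sum, norm1, Finset.mul_sum, ← Finset.sum_add_distrib]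
    refine Finset.sum_congr rfl fun i _ => ?_
    rw [Finset.mul_sum, Finset.sum_add_distrib]
  have hsum' : γ * norm1 (S + N) = ∑ i, ∑ j, γ * |(S + N) i j| := by
    simp only [norm1, Finset.mul_sum]
  have hS_le : γ * norm1 S + (Qᵀ * N).trace ≤ γ * norm1 (S + N) := by
    rw [hsum, hsum']
    exact Finset.sum_le_sum fun i _ => Finset.sum_le_sum fun j _ => (hent i j).1
  set K := (1 - P) * N * (1 - P) with hK
  set F := (1 - P) * Q * (1 - P) with hF
  have hcc : ∀ A : Matrix (Fin n) (Fin n) ℝ, (1 - P) * ((1 - P) * A * (1 - P)) =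
      (1 - P) * A * (1 - P) := fun A => by
    rw [← Matrix.mul_assoc, ← Matrix.mul_assoc, h.compl_mul_compl]
  have hcc' : ∀ A : Matrix (Fin n) (Fin n) ℝ, (1 - P) * A * (1 - P) * (1 - P) =
      (1 - P) * A * (1 - P) := fun A => by rw [Matrix.mul_assoc, h.compl_mul_compl]
  -- As `‖F‖ < 1`, the normal part of `Q` can be tilted by `-δK` and remain a contraction; testing
  -- against `L - N` then gains `δ‖K‖²` in Frobenius norm. The `+ 1` in the denominator covers `K =
  -- 0`.
  obtain ⟨δ, hδ, hδF⟩ : ∃ δ : ℝ, 0 < δ ∧ ‖F - δ • K‖ ≤ 1 := by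
    have hpos : 0 < ‖K‖ + 1 := by positivity
    refine ⟨(1 - ‖F‖) / (‖K‖ + 1), div_pos (sub_pos.mpr hQn) hpos, ?_⟩
    refine (norm_sub_le _ _).trans ?_
    rw [norm_smul, Real.norm_of_nonneg (div_pos (sub_pos.mpr hQn) hpos).le, div_mul_eq_mul_div]
    have : (1 - ‖F‖) * ‖K‖ / (‖K‖ + 1) ≤ 1 - ‖F‖ := by
      rw [div_le_iff₀ hpos]
      nlinarith
    linarith
  have hGn : ‖W + (F - δ • K)‖ ≤ 1 := by
    refine h.norm_polar_add_le hδF ?_ ?_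
    · rw [Matrix.mul_sub, Matrix.mul_smul, hcc, hcc]
    · rw [Matrix.sub_mul, Matrix.smul_mul, hcc', hcc']
  have hdual := trace_transpose_mul_le _ (L - N) hGn
  have hFL : ∀ A : Matrix (Fin n) (Fin n) ℝ, (((1 - P) * A * (1 - P))ᵀ * L).trace = 0 := by
    intro A
    rw [Matrix.transpose_mul, h.transpose_compl, Matrix.transpose_mul, h.transpose_compl,
      Matrix.mul_assoc, Matrix.mul_assoc, h.compl_mul]
    simp
  have hKN : (Kᵀ * N).trace = (Kᵀ * K).trace := by
    have e1 : Kᵀ = (1 - P) * Kᵀ * (1 - P) := by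
      rw [h.transpose_compl_mul_mul hN, Matrix.mul_neg, Matrix.neg_mul, hcc, hcc']
    conv_lhs => rw [e1, Matrix.mul_assoc, Matrix.mul_assoc, Matrix.trace_mul_comm,
      Matrix.mul_assoc]
  have hQW : Q = W + F := eq_add_of_sub_eq hQT
  have hval : ((W + (F - δ • K))ᵀ * (L - N)).trace =
      normNuc L - (Qᵀ * N).trace + δ * (Kᵀ * K).trace := by
    rw [← hKN, ← h.trace_polar, hQW]
    have hF0 := hFL Q
    have hK0 := hFL N
    rw [← hF] at hF0
    rw [← hK] at hK0
    simp only [Matrix.transpose_add, Matrix.transpose_sub, Matrix.transpose_smul, Matrix.add_mul,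
      Matrix.sub_mul, Matrix.mul_sub, Matrix.smul_mul, Matrix.trace_add, Matrix.trace_sub,
      Matrix.trace_smul, hF0, hK0, smul_eq_mul]
    ring
  rw [hval] at hdual
  have hKK : (Kᵀ * K).trace = ∑ i, ∑ j, K i j * K i j := trace_transpose_mul_eq_sum K K
  have hKK0 : 0 ≤ (Kᵀ * K).trace := by
    rw [hKK]
    exact Finset.sum_nonneg fun i _ => Finset.sum_nonneg fun j _ => mul_self_nonneg _
  have hδK := mul_nonneg hδ.le hKK0
  change γ * norm1 S + normNuc L < γ * norm1 (S + N) + normNuc (L - N)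
  by_cases hNO : ∃ i j, S i j = 0 ∧ N i j ≠ 0
  · obtain ⟨i, j, hij, hNij⟩ := hNO
    have : γ * norm1 S + (Qᵀ * N).trace < γ * norm1 (S + N) := by
      rw [hsum, hsum']
      exact Finset.sum_lt_sum (fun i _ => Finset.sum_le_sum fun j _ => (hent i j).1)
        ⟨i, Finset.mem_univ i, Finset.sum_lt_sum (fun j _ => (hent i j).1)
          ⟨j, Finset.mem_univ j, (hent i j).2 hij hNij⟩⟩
    linarith
  · push Not at hNO
    have hNΩ : N ∈ Omega S := ⟨hN, fun p hp hS0 => hp (hNO p.1 p.2 hS0)⟩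
    have hK_ne : K ≠ 0 := by
      -- `K = 0` would make `N` tangent as well as an element of `Ω(S)`, so its maximum norm would
      -- be at most `μξ < 1` times itself.
      intro hK0
      have h1 := normMax_le_xi_mul h hN hK0
      have h2 := mul_le_mul_of_nonneg_left (norm_le_mu_mul hNΩ) (xi_nonneg L)
      refine hN0 (eq_zero_of_normMax_le_zero ?_)
      nlinarith [normMax_nonneg N]
    have hKpos : 0 < (Kᵀ * K).trace := by
      refine hKK0.lt_of_ne fun h0 => hK_ne ?_
      ext i j
      have h1 := (Finset.sum_eq_zero_iff_of_nonneg fun i _ =>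
        Finset.sum_nonneg fun j _ => mul_self_nonneg (K i j)).mp (hKK.symm.trans h0.symm) i
          (Finset.mem_univ i)
      have h2 := (Finset.sum_eq_zero_iff_of_nonneg fun j _ => mul_self_nonneg (K i j)).mp h1 j
        (Finset.mem_univ j)
      exact mul_self_eq_zero.mp h2
    have := mul_pos hδ hKpos
    linarith

end SkewDecomp

/-! ### Unique optimality of the pair. -/

/-- The upper bound on `γ` is only imposed when `μ(S) ≠ 0`: for `μ(S) = 0` the right endpoint
`(1 - 3 μ ξ) / μ` of the interval is `+∞`. -/
theorem proposition2 (n : ℕ) (C S L : Matrix (Fin n) (Fin n) ℝ)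
    (hS : S ∈ SkewDecomp.Skew n) (hL : L ∈ SkewDecomp.Skew n) (hC : C = S + L)
    (hmuxi : SkewDecomp.mu S * SkewDecomp.xi L < 1 / 6)
    (γ : ℝ)
    (hlower : SkewDecomp.xi L / (1 - 4 * (SkewDecomp.mu S * SkewDecomp.xi L)) < γ)
    (hupper : SkewDecomp.mu S ≠ 0 →
      γ < (1 - 3 * (SkewDecomp.mu S * SkewDecomp.xi L)) / SkewDecomp.mu S) :
    SkewDecomp.optima γ C = {(S, L)} := by
  have hS' : Sᵀ = -S := hS
  have hL' : Lᵀ = -L := hL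
  obtain ⟨P, W, h⟩ := SkewDecomp.exists_isPolarPair L hL'
  have hfeas : (S, L) ∈ SkewDecomp.feasible C :=
    ⟨hC.symm, by rw [hS', add_neg_cancel], by rw [hL', add_neg_cancel]⟩
  have hlt : ∀ q ∈ SkewDecomp.feasible C, q ≠ (S, L) →
      SkewDecomp.objective γ (S, L) < SkewDecomp.objective γ q := by
    -- Every feasible pair has the form `(S + N, L - N)` with `N = S' - S` skew-symmetric.
    rintro ⟨S', L'⟩ ⟨hsum, hS1, -⟩ hne
    have hN : (S' - S)ᵀ = -(S' - S) := by
      rw [Matrix.transpose_sub, hS', eq_neg_of_add_eq_zero_right hS1]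
      abel
    have hLN : L - (S' - S) = L' := by
      rw [show L' = C - S' from eq_sub_of_add_eq' hsum, hC]
      abel
    have hN0 : S' - S ≠ 0 := fun h0 => hne <| by
      rw [h0, sub_zero] at hLN
      rw [sub_eq_zero.mp h0, hLN]
    have := h.objective_lt hS' hmuxi hlower hupper hN hN0
    rwa [add_sub_cancel, hLN] at this
  ext q
  constructor
  · rintro ⟨hq, hmin⟩
    by_contra hne
    exact absurd (hmin _ hfeas) (not_le.mpr (hlt q hq hne))
  · rintro rfl
    refine ⟨hfeas, fun q hq => ?_⟩
    by_cases hne : q = (S, L)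
    · rw [hne]
    · exact (hlt q hq hne).le
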